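/- Let $R$ be an associative and commutative ring with identity containing the field of rational numbers, $\mathbb{Q}=\mathbb{Q}\cdot 1\subseteq R$, regarded as a ring of constants, and let $A$ be a differential $R$-algebra with derivation operators $\delta_1,\ldots,\delta_m$, that is, a commutative $R$-algebra with identity equipped with pairwise commuting $R$-linear derivations $\delta_1,\ldots,\delta_m\colon A\to A$. Assume that $A$ has no nonzero nilpotent elements and satisfies the ascending chain condition for radical differential ideals (ideals $I$ such that $\delta_i(I)\subseteq I$ for all $i$, and $f^k\in I$ for some $k\ge 1$ implies $f\in I$). Then $A$ is equationally Noetherian as a differential $R$-algebra: for every natural number $n$, let $A\{y_1,\ldots,y_n\}=A[\,y_j^{\theta} : 1\le j\le n,\ \theta=\delta_1^{i_1}\cdots\delta_m^{i_m}\,]$ be the differential polynomial algebra, whose elements are evaluated at a tuple $(a_1,\ldots,a_n)\in A^n$ by substituting $\theta(a_j)$ for $y_j^{\theta}$; then $A^n$ is a Noetherian topological space with respect to the Zariski topology, the coarsest topology in which all the sets $$Z(S)=\{(a_1,\ldots,a_n)\in A^n : f(a_1,\ldots,a_n)=0 \text{ for all } f\in S\},\qquad S\subseteq A\{y_1,\ldots,y_n\},$$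 are closed. -/

import Mathlib

namespace DiffAlg

noncomputable section

open MvPolynomial

/-! Throughout, a differential `R`-algebra with `m` derivation operators is a commutative
`R`-algebra `A` together with `R`-linear derivations `δ 0, …, δ (m - 1)` of `A` that commute
pairwise. The `R`-linearity says that `R` is regarded as a ring of constants. -/

section Basic

variable {R A : Type*} [CommRing R] [CommRing A] [Algebra R A] {m : ℕ}

/-- The derivations of the family commute pairwise. -/
def PairwiseCommute (δ : Fin m → Derivation R A A) : Prop :=
  ∀ i j a, δ i (δ j a) = δ j (δ i a)

/-- An ideal is differential if it is stable under all derivations. -/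
def IsDifferentialIdeal (δ : Fin m → Derivation R A A) (I : Ideal A) : Prop :=
  ∀ i, ∀ a ∈ I, δ i a ∈ I

/-- The ascending chain condition for radical differential ideals: every ascending sequence
of radical differential ideals becomes constant. -/
def RadicallyNoetherian (δ : Fin m → Derivation R A A) : Prop :=
  ∀ I : ℕ → Ideal A, Monotone I → (∀ k, (I k).IsRadical ∧ IsDifferentialIdeal δ (I k)) →
    ∃ N, ∀ k, N ≤ k → I k = I N

/-- Derivative operators `δ_0 ^ θ_0 ⋯ δ_{m-1} ^ θ_{m-1}`: the free commutative monoid on the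
derivation symbols, written additively through exponents. -/
abbrev Theta (m : ℕ) : Type := Fin m →₀ ℕ

/-- The action on `A` of the derivative operator `δ_0 ^ θ_0 ⋯ δ_{m-1} ^ θ_{m-1}`. -/
def applyTheta (δ : Fin m → Derivation R A A) (θ : Theta m) : Module.End R A :=
  ((List.finRange m).map fun i => ((δ i : A →ₗ[R] A) : Module.End R A) ^ θ i).prod

theorem applyTheta_zero (δ : Fin m → Derivation R A A) (a : A) : applyTheta δ 0 a = a := by
  simp [applyTheta]

theorem applyTheta_add_single {δ : Fin m → Derivation R A A} (hδ : PairwiseCommute δ)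
    (θ : Theta m) (i : Fin m) (a : A) :
    applyTheta δ (θ + Finsupp.single i 1) a = δ i (applyTheta δ θ a) := by
  set d : Fin m → Module.End R A := fun j => (δ j : A →ₗ[R] A) with hd
  have hc : ∀ j k, Commute (d j) (d k) := fun j k => LinearMap.ext fun a => hδ j k a
  have h0 : ∀ l : List (Fin m), i ∉ l →
      (l.map fun j => d j ^ (θ + Finsupp.single i 1 : Theta m) j).prod = (l.map fun j => d j ^ θ j).prod := by
    intro l hl
    congr 1
    refine List.map_congr_left fun j hj => ?_
    have : i ≠ j := fun h => hl (h ▸ hj)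
    simp [this]
  have h1 : ∀ l : List (Fin m), l.Nodup → i ∈ l →
      (l.map fun j => d j ^ (θ + Finsupp.single i 1 : Theta m) j).prod =
        d i * (l.map fun j => d j ^ θ j).prod := by
    intro l
    induction l with
    | nil => simp
    | cons k l ih =>
      intro hn hm
      rw [List.nodup_cons] at hn
      rw [List.map_cons, List.map_cons, List.prod_cons, List.prod_cons]
      by_cases hik : i = k
      · subst hik
        rw [h0 l hn.1, ← mul_assoc, ← pow_succ']
        simp
      · have hl : i ∈ l := by simpa [hik] using hm
        rw [ih hn.2 hl, ← mul_assoc, ← mul_assoc, ((hc k i).pow_left _).eq.symm]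
        have hz : (θ + Finsupp.single i 1 : Theta m) k = θ k := by simp [hik]
        rw [hz, ((hc k i).pow_left _).eq]
  exact congrArg (fun f : Module.End R A => f a)
    (h1 _ (List.nodup_finRange m) (List.mem_finRange i))

/-- The ring `A{y_0, …, y_{n-1}}` of differential polynomials over a differential ring with `m`
derivation operators: the polynomial ring over `A` in the variables `y_i ^ θ`. -/
abbrev DiffPoly (A : Type*) [CommRing A] (m n : ℕ) : Type _ :=
  MvPolynomial (Fin n × Theta m) A

/-- A derivation of `A` acting on the coefficients of polynomials, as a linear map. -/
def coeffLinear (σ : Type*) (d : Derivation R A A) : MvPolynomial σ A →ₗ[R] MvPolynomial σ A :=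
  (AddMonoidAlgebra.coeffLinearEquiv R).symm.toLinearMap ∘ₗ
    Finsupp.mapRange.linearMap (d : A →ₗ[R] A) ∘ₗ
      (AddMonoidAlgebra.coeffLinearEquiv R).toLinearMap

theorem coeff_coeffLinear {σ : Type*} (d : Derivation R A A) (p : MvPolynomial σ A) (s : σ →₀ ℕ) :
    coeff s (coeffLinear σ d p) = d (coeff s p) := rfl

theorem coeffLinear_monomial {σ : Type*} (d : Derivation R A A) (s : σ →₀ ℕ) (a : A) :
    coeffLinear σ d (monomial s a) = monomial s (d a) := by
  classical
  ext t
  rw [coeff_coeffLinear, coeff_monomial, coeff_monomial]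
  split_ifs <;> simp

/-- A derivation of `A` acting on the coefficients of polynomials, as a derivation. -/
def coeffDerivation (σ : Type*) (d : Derivation R A A) :
    Derivation R (MvPolynomial σ A) (MvPolynomial σ A) :=
  Derivation.mk' (coeffLinear σ d) fun p q => by
    induction p using MvPolynomial.induction_on' with
    | add p₁ p₂ h₁ h₂ => simp only [add_mul, map_add, h₁, h₂, smul_eq_mul, mul_add]; ring
    | monomial s a =>
      induction q using MvPolynomial.induction_on' with
      | add q₁ q₂ h₁ h₂ =>
        simp only [mul_add, map_add, h₁, h₂, smul_eq_mul, add_mul]; ring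
      | monomial t b =>
        simp only [monomial_mul, coeffLinear_monomial, smul_eq_mul, Derivation.leibniz, map_add]
        rw [add_comm t s, mul_comm b]

theorem coeffDerivation_C {σ : Type*} (d : Derivation R A A) (a : A) :
    coeffDerivation σ d (C a) = C (d a) := coeffLinear_monomial d 0 a

theorem coeffDerivation_X {σ : Type*} (d : Derivation R A A) (x : σ) :
    coeffDerivation σ d (X x) = 0 := by
  have : coeffDerivation σ d (X x) = monomial _ (d 1) := coeffLinear_monomial d _ 1
  rw [this, Derivation.map_one_eq_zero, map_zero]

/-- The derivations of `A{y_0, …, y_{n-1}}`: they extend those of `A`, and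
`δ_i (y_j ^ θ) = y_j ^ (δ_i θ)`. -/
def polyDerivation (δ : Fin m → Derivation R A A) (n : ℕ) (i : Fin m) :
    Derivation R (DiffPoly A m n) (DiffPoly A m n) :=
  coeffDerivation _ (δ i) +
    (mkDerivation A fun x : Fin n × Theta m =>
      (X (x.1, x.2 + Finsupp.single i 1) : DiffPoly A m n)).restrictScalars R

theorem polyDerivation_C (δ : Fin m → Derivation R A A) (n : ℕ) (i : Fin m) (a : A) :
    polyDerivation δ n i (C a) = C (δ i a) := by
  simp [polyDerivation, coeffDerivation_C]

theorem polyDerivation_X (δ : Fin m → Derivation R A A) (n : ℕ) (i : Fin m)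
    (x : Fin n × Theta m) :
    polyDerivation δ n i (X x) = X (x.1, x.2 + Finsupp.single i 1) := by
  simp [polyDerivation, coeffDerivation_X]

theorem polyDerivation_commute {δ : Fin m → Derivation R A A} (hδ : PairwiseCommute δ) (n : ℕ) :
    PairwiseCommute (polyDerivation δ n) := by
  intro i j p
  induction p using MvPolynomial.induction_on with
  | C a => simp only [polyDerivation_C, hδ i j]
  | add p q hp hq => simp only [map_add, hp, hq]
  | mul_X p x hp =>
    simp only [Derivation.leibniz, map_add, smul_eq_mul, hp, polyDerivation_X, add_right_comm _
      (Finsupp.single i 1) (Finsupp.single j 1)]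
    ring

/-- The value `f(a_0, …, a_{n-1})` of a differential polynomial at a tuple of elements of `A`:
the variable `y_i ^ θ` is replaced by `θ(a_i)`. -/
def evalAt (δ : Fin m → Derivation R A A) {n : ℕ} (a : Fin n → A) : DiffPoly A m n →ₐ[A] A :=
  aeval fun x => applyTheta δ x.2 (a x.1)

/-- `A{y_0, …, y_{n-1}}` is the coproduct of `A` and the free differential `R`-algebra on `n`
generators: a differential homomorphism out of `A` and a tuple of elements of its target `B`
extend uniquely to a differential homomorphism out of `A{y_0, …, y_{n-1}}`. -/
theorem existsUnique_extension {B : Type*} [CommRing B] [Algebra R B]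
    (δ : Fin m → Derivation R A A)
    {ε : Fin m → Derivation R B B} (hε : PairwiseCommute ε)
    (φ : A →ₐ[R] B) (hφ : ∀ i a, φ (δ i a) = ε i (φ a)) {n : ℕ} (b : Fin n → B) :
    ∃! ψ : DiffPoly A m n →ₐ[R] B, (∀ i f, ψ (polyDerivation δ n i f) = ε i (ψ f)) ∧
      (∀ a, ψ (C a) = φ a) ∧ ∀ j, ψ (X (j, 0)) = b j := by
  let ψ₀ : DiffPoly A m n →ₐ[R] B :=
    { eval₂Hom (φ : A →+* B) fun x => applyTheta ε x.2 (b x.1) with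
      commutes' := fun r => by
        rw [IsScalarTower.algebraMap_apply R A (DiffPoly A m n)]
        simp [MvPolynomial.algebraMap_eq] }
  have hC : ∀ a, ψ₀ (C a) = φ a := fun a => eval₂Hom_C _ _ a
  have hX : ∀ x, ψ₀ (X x) = applyTheta ε x.2 (b x.1) := fun x => eval₂Hom_X' _ _ x
  refine ⟨ψ₀, ⟨?_, hC, fun j => by rw [hX, applyTheta_zero]⟩, ?_⟩
  · intro i f
    induction f using MvPolynomial.induction_on with
    | C a => rw [polyDerivation_C, hC, hC, hφ]
    | add p q hp hq => simp only [map_add, hp, hq]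
    | mul_X p x hp =>
      simp only [Derivation.leibniz, map_add, map_mul, smul_eq_mul, hp, polyDerivation_X, hX,
        applyTheta_add_single hε]
  · rintro ψ ⟨hd, hc, hx⟩
    have hX' : ∀ j (θ : Theta m), ψ (X (j, θ)) = applyTheta ε θ (b j) := by
      intro j θ
      have step : ∀ (θ : Theta m) i, ψ (X (j, θ)) = applyTheta ε θ (b j) →
          ψ (X (j, θ + Finsupp.single i 1)) =
            applyTheta ε (θ + Finsupp.single i 1) (b j) := by
        intro θ i h
        rw [applyTheta_add_single hε, ← h, ← hd, polyDerivation_X]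
      have main : ∀ η θ : Theta m, ψ (X (j, θ)) = applyTheta ε θ (b j) →
          ψ (X (j, θ + η)) = applyTheta ε (θ + η) (b j) := by
        intro η
        induction η using Finsupp.induction_linear with
        | zero => intro θ h; rw [add_zero, h]
        | add f g hf hg => intro θ h; rw [← add_assoc]; exact hg _ (hf _ h)
        | single i k =>
          induction k with
          | zero => intro θ h; rw [Finsupp.single_zero, add_zero, h]
          | succ k ih => intro θ h; rw [Finsupp.single_add, ← add_assoc]; exact step _ _ (ih _ h)
      have h := main θ 0 (by rw [hx, applyTheta_zero])
      rwa [zero_add] at h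
    apply AlgHom.ext
    intro f
    induction f using MvPolynomial.induction_on with
    | C a => rw [hc, hC]
    | add p q hp hq => simp only [map_add, hp, hq]
    | mul_X p x hp => rw [map_mul, map_mul, hp, hX, hX']

/-- Evaluation at a tuple is the differential homomorphism `A{y_0, …, y_{n-1}} → A` that is the
identity on `A` and sends each `y_j` to `a_j`. -/
theorem evalAt_spec {δ : Fin m → Derivation R A A} (hδ : PairwiseCommute δ) {n : ℕ}
    (a : Fin n → A) :
    (∀ i f, evalAt δ a (polyDerivation δ n i f) = δ i (evalAt δ a f)) ∧
      (∀ c, evalAt δ a (C c) = c) ∧ ∀ j, evalAt δ a (X (j, 0)) = a j := by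
  have hC : ∀ c, evalAt δ a (C c) = c := fun c => by simp [evalAt]
  have hX : ∀ x, evalAt δ a (X x) = applyTheta δ x.2 (a x.1) := fun x => by simp [evalAt]
  refine ⟨?_, hC, fun j => by rw [hX, applyTheta_zero]⟩
  intro i f
  induction f using MvPolynomial.induction_on with
  | C c => rw [polyDerivation_C, hC, hC]
  | add p q hp hq => simp only [map_add, hp, hq]
  | mul_X p x hp =>
    simp only [Derivation.leibniz, map_add, map_mul, smul_eq_mul, hp, polyDerivation_X, hX,
      applyTheta_add_single hδ]

/-- The set of zeroes in `A ^ n` of a set of differential polynomials. -/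
def zeroSet (δ : Fin m → Derivation R A A) {n : ℕ} (S : Set (DiffPoly A m n)) :
    Set (Fin n → A) :=
  {a | ∀ f ∈ S, evalAt δ a f = 0}

/-- The Zariski topology on `A ^ n`: the coarsest topology in which all sets of zeroes are
closed. -/
abbrev zariskiTopology (δ : Fin m → Derivation R A A) (n : ℕ) : TopologicalSpace (Fin n → A) :=
  TopologicalSpace.generateFrom {U | ∃ S : Set (DiffPoly A m n), U = (zeroSet δ S)ᶜ}

/-- `A` is equationally Noetherian: for every `n`, the space `A ^ n` with the Zariski topology is
a Noetherian topological space. -/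
def EquationallyNoetherian (δ : Fin m → Derivation R A A) : Prop :=
  ∀ n : ℕ, @TopologicalSpace.NoetherianSpace (Fin n → A) (zariskiTopology δ n)

end Basic

end

end DiffAlg

/-! Since `A` is reduced, the kernel of evaluation at a point of `A ^ n` is a radical differential
ideal. The zeroes of a set `S` of equations are therefore the zeroes of the radical differential
ideal it generates, and everything reduces to the Ritt–Raudenbush basis theorem
(`RadicallyNoetherian.rdFinite_diffPoly`): each radical differential ideal of `A{y}` is generated,
as such, by finitely many elements. These may be taken from `S`, and compactness of every subset of
`A ^ n` follows by Alexander's subbasis theorem.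

If the basis theorem fails, Zorn's lemma gives a maximal counterexample `P`, which is prime
(`exists_prime_maximal_not_rdFinite`). For each variable that leads an element of `P` nontrivially,
take such an element of least degree. By Dickson's lemma these leaders are derivatives of finitely
many among them. The initials and separants of the corresponding finite set `F` multiply to some `s
∉ P`, and pseudo-division by `F` and its derivatives gives `s * P ⊆ J` for every radical
differential `J ⊆ P` containing `F` and the constants of `P` (`exists_finite_mul_mem`). Those
constants are finitely generated by the hypothesis on `A`, and by maximality `P` lies in the radical
differential ideal of `s` and a finite `U ⊆ P`. Together these finite sets generate `P`, a
contradiction. -/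

namespace DiffAlg

/-! ### Radical differential ideals and finite generation -/

section RadicalDifferential

variable {R B : Type*} [CommRing R] [CommRing B] [Algebra R B] {m : ℕ}

/-- An ideal that is radical and stable under all derivations. -/
structure IsRadDiff (δ : Fin m → Derivation R B B) (I : Ideal B) : Prop where
  radical : I.IsRadical
  differential : IsDifferentialIdeal δ I

/-- The radical differential ideal generated by a set. -/
def rdSpan (δ : Fin m → Derivation R B B) (S : Set B) : Ideal B :=
  sInf {I | IsRadDiff δ I ∧ S ⊆ I}

variable {δ : Fin m → Derivation R B B}

theorem mem_rdSpan {S : Set B} {x : B} :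
    x ∈ rdSpan δ S ↔ ∀ I, IsRadDiff δ I → S ⊆ I → x ∈ I := by
  simp [rdSpan]

theorem subset_rdSpan (S : Set B) : S ⊆ rdSpan δ S :=
  fun _ hx => mem_rdSpan.2 fun _ _ h => h hx

theorem isRadDiff_rdSpan (S : Set B) : IsRadDiff δ (rdSpan δ S) where
  radical := by
    rintro x ⟨k, hk⟩
    exact mem_rdSpan.2 fun I hI hS => hI.radical ⟨k, mem_rdSpan.1 hk I hI hS⟩
  differential i x hx :=
    mem_rdSpan.2 fun I hI hS => hI.differential i x (mem_rdSpan.1 hx I hI hS)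

theorem rdSpan_le {S : Set B} {I : Ideal B} (hI : IsRadDiff δ I) (h : S ⊆ I) :
    rdSpan δ S ≤ I := fun _ hx => mem_rdSpan.1 hx I hI h

theorem rdSpan_mono {S T : Set B} (h : S ⊆ T) : rdSpan δ S ≤ rdSpan δ T :=
  rdSpan_le (isRadDiff_rdSpan T) (h.trans (subset_rdSpan T))

theorem IsRadDiff.mem_of_mul_self {I : Ideal B} (hI : IsRadDiff δ I) {x : B}
    (h : x * x ∈ I) : x ∈ I :=
  hI.radical ⟨2, by rwa [pow_two]⟩

/-- The elements whose product with `t` lies in `I`. -/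
def colonElem (I : Ideal B) (t : B) : Ideal B := Submodule.comap (LinearMap.mulLeft B t) I

theorem mem_colonElem {I : Ideal B} {t x : B} : x ∈ colonElem I t ↔ t * x ∈ I := Iff.rfl

/-- For the differential part: modulo `I`, multiplying `δ (t * x) ∈ I` by `t * δ x` leaves `(t * δ
x) ^ 2`, because the other term is a multiple of `t * x`. Radicality then removes the square. -/
theorem IsRadDiff.colonElem {I : Ideal B} (hI : IsRadDiff δ I) (t : B) :
    IsRadDiff δ (colonElem I t) where
  radical := by
    rintro x ⟨k, hk⟩
    rw [mem_colonElem] at hk ⊢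
    refine hI.radical ⟨k + 1, ?_⟩
    have : (t * x) ^ (k + 1) = (t ^ k * x) * (t * x ^ k) := by ring
    rw [this]
    exact I.mul_mem_left _ hk
  differential i x hx := by
    rw [mem_colonElem] at hx ⊢
    apply hI.mem_of_mul_self
    have h1 := I.mul_mem_left (t * δ i x) (hI.differential i _ hx)
    have h2 := I.mul_mem_left (δ i x * δ i t) hx
    rw [Derivation.leibniz, smul_eq_mul, smul_eq_mul] at h1
    have := I.sub_mem h1 h2
    convert this using 1
    ring

/-- Colon ideals are radical differential, so generators may be replaced by the ideals they generate
one factor at a time: first `T` for fixed `s`, then `S` for fixed `y`. -/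
theorem mul_mem_of_mem_rdSpan {S T : Set B} {I : Ideal B} (hI : IsRadDiff δ I)
    (h : ∀ s ∈ S, ∀ t ∈ T, s * t ∈ I) {x y : B} (hx : x ∈ rdSpan δ S) (hy : y ∈ rdSpan δ T) :
    x * y ∈ I := by
  have h1 : ∀ s ∈ S, s * y ∈ I := fun s hs =>
    mem_colonElem.1 (rdSpan_le (hI.colonElem s) (fun t ht => h s hs t ht) hy)
  rw [mul_comm]
  exact mem_colonElem.1 (rdSpan_le (hI.colonElem y)
    (fun s hs => by rw [SetLike.mem_coe, mem_colonElem, mul_comm]; exact h1 s hs) hx)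

/-- A directed union of radical differential ideals is a radical differential ideal. -/
theorem isRadDiff_of_directed {ι : Type*} {f : ι → Ideal B} {I : Ideal B}
    (hf : ∀ i, IsRadDiff δ (f i)) (hI : ∀ x, x ∈ I ↔ ∃ i, x ∈ f i) : IsRadDiff δ I where
  radical := by
    rintro x ⟨k, hk⟩
    obtain ⟨i, hi⟩ := (hI _).1 hk
    exact (hI x).2 ⟨i, (hf i).radical ⟨k, hi⟩⟩
  differential j x hx := by
    obtain ⟨i, hi⟩ := (hI _).1 hx
    exact (hI _).2 ⟨i, (hf i).differential j x hi⟩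

/-- The ideals generated by finite subsets of `S` are directed, so their union is already radical
differential and contains `S`. -/
theorem exists_finset_of_mem_rdSpan {S : Set B} {x : B} (hx : x ∈ rdSpan δ S) :
    ∃ T : Finset B, (T : Set B) ⊆ S ∧ x ∈ rdSpan δ (T : Set B) := by
  classical
  let f : {T : Finset B // (T : Set B) ⊆ S} → Ideal B := fun T => rdSpan δ (T.1 : Set B)
  have : Nonempty {T : Finset B // (T : Set B) ⊆ S} := ⟨⟨∅, by simp⟩⟩
  have hdir : Directed (· ≤ ·) f := fun T U =>
    ⟨⟨T.1 ∪ U.1, by simp [T.2, U.2]⟩, rdSpan_mono (by simp), rdSpan_mono (by simp)⟩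
  have hmem : ∀ x, x ∈ iSup f ↔ ∃ i, x ∈ f i := fun x => Submodule.mem_iSup_of_directed f hdir
  have h := rdSpan_le (isRadDiff_of_directed (fun T => isRadDiff_rdSpan _) hmem)
    (S := S) (fun y hy => (hmem y).2 ⟨⟨{y}, by simpa using hy⟩, subset_rdSpan _ (by simp)⟩) hx
  obtain ⟨T, hT⟩ := (hmem x).1 h
  exact ⟨T.1, T.2, hT⟩

theorem exists_finset_of_subset_rdSpan {S : Set B} (U : Finset B)
    (hU : (U : Set B) ⊆ rdSpan δ S) :
    ∃ T : Finset B, (T : Set B) ⊆ S ∧ (U : Set B) ⊆ rdSpan δ (T : Set B) := by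
  classical
  choose! T hT using fun x (hx : x ∈ U) => exists_finset_of_mem_rdSpan (hU hx)
  refine ⟨U.biUnion T, ?_, fun x hx => ?_⟩
  · simpa using fun x hx => (hT x hx).1
  · exact rdSpan_mono (by exact_mod_cast Finset.subset_biUnion_of_mem T hx) (hT x hx).2

/-- `I` is the radical differential ideal generated by a finite set. -/
def RDFinite (δ : Fin m → Derivation R B B) (I : Ideal B) : Prop :=
  ∃ T : Finset B, I = rdSpan δ (T : Set B)

theorem RDFinite.exists_subset {S : Set B} (h : RDFinite δ (rdSpan δ S)) :
    ∃ T : Finset B, (T : Set B) ⊆ S ∧ rdSpan δ S = rdSpan δ (T : Set B) := by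
  obtain ⟨U, hU⟩ := h
  obtain ⟨T, hTS, hT⟩ := exists_finset_of_subset_rdSpan (δ := δ) (S := S) U
    (hU ▸ subset_rdSpan _)
  exact ⟨T, hTS, le_antisymm (hU ▸ rdSpan_le (isRadDiff_rdSpan _) hT) (rdSpan_mono hTS)⟩

theorem RDFinite.exists_subset_insert {I : Ideal B} {a : B}
    (h : RDFinite δ (rdSpan δ (insert a (I : Set B)))) :
    ∃ T : Finset B, (T : Set B) ⊆ I ∧ (I : Set B) ⊆ rdSpan δ (insert a (T : Set B)) := by
  classical
  obtain ⟨T, hT, h⟩ := h.exists_subset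
  refine ⟨T.erase a, fun x hx => ?_, fun x hx => ?_⟩
  · have hx' : x ≠ a ∧ x ∈ T := by simpa [and_comm] using hx
    exact (hT hx'.2).resolve_left hx'.1
  · have : x ∈ rdSpan δ (T : Set B) := h ▸ subset_rdSpan _ (Set.mem_insert_of_mem a hx)
    refine rdSpan_mono (fun y hy => ?_) this
    by_cases hya : y = a
    · exact Or.inl hya
    · exact Or.inr (by simpa [hya] using hy)

theorem RadicallyNoetherian.rdFinite (h : RadicallyNoetherian δ) {I : Ideal B}
    (hI : IsRadDiff δ I) : RDFinite δ I := by
  classical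
  have hwf : WellFoundedGT {I : Ideal B // IsRadDiff δ I} := by
    rw [wellFoundedGT_iff_monotone_chain_condition]
    intro a
    obtain ⟨N, hN⟩ := h (fun k => (a k).1) (fun i j hij => a.monotone hij)
      (fun k => ⟨(a k).2.radical, (a k).2.differential⟩)
    exact ⟨N, fun k hk => Subtype.ext (hN k hk).symm⟩
  -- Minimal for `>`: a largest ideal among those generated by finite subsets of `I`.
  obtain ⟨T, hT, hmax⟩ := hwf.wf.has_min
    {J | ∃ T : Finset B, (T : Set B) ⊆ I ∧ J = ⟨rdSpan δ (T : Set B), isRadDiff_rdSpan _⟩}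
    ⟨_, ∅, by simp, rfl⟩
  obtain ⟨T, hTI, rfl⟩ := hT
  refine ⟨T, le_antisymm (fun x hx => ?_) (rdSpan_le hI hTI)⟩
  by_contra hxT
  refine hmax _ ⟨insert x T, by simpa [Set.insert_subset_iff] using ⟨hx, hTI⟩, rfl⟩ ?_
  refine lt_of_le_of_ne (rdSpan_mono (by simp)) fun heq => hxT ?_
  have := congrArg Subtype.val heq
  dsimp only at this
  rw [this]
  exact subset_rdSpan _ (by simp)

/-- If some radical differential ideal is not finitely generated as such, then there is a maximal
one, and it is prime. -/
theorem exists_prime_maximal_not_rdFinite {I₀ : Ideal B} (hI₀ : IsRadDiff δ I₀)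
    (hn : ¬ RDFinite δ I₀) :
    ∃ P : Ideal B, P.IsPrime ∧ IsRadDiff δ P ∧ ¬ RDFinite δ P ∧
      ∀ a ∉ P, ∃ T : Finset B, (T : Set B) ⊆ P ∧ (P : Set B) ⊆ rdSpan δ (insert a (T : Set B)) := by
  classical
  obtain ⟨P, -, hmax⟩ := zorn_le_nonempty₀ {I : Ideal B | IsRadDiff δ I ∧ ¬ RDFinite δ I}
    (by
      intro c hc hchain y hy
      have hdir : DirectedOn (· ≤ ·) c := hchain.directedOn
      have hmem : ∀ x, x ∈ sSup c ↔ ∃ i : c, x ∈ i.1 := fun x => by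
        rw [Submodule.mem_sSup_of_directed ⟨y, hy⟩ hdir]; simp
      have hrd : IsRadDiff δ (sSup c) := isRadDiff_of_directed (fun i : c => (hc i.2).1) hmem
      refine ⟨sSup c, ⟨hrd, ?_⟩, fun z hz => le_sSup hz⟩
      rintro ⟨T, hT⟩
      -- A finite generating set of the union of the chain lies in a single member, which it would
      -- then generate.
      have key : ∀ U : Finset B, (U : Set B) ⊆ (sSup c : Ideal B) → ∃ J ∈ c, (U : Set B) ⊆ J := by
        intro U
        induction U using Finset.induction_on with
        | empty => exact fun _ => ⟨y, hy, by simp⟩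
        | insert a U _ ih =>
          intro hU
          rw [Finset.coe_insert, Set.insert_subset_iff] at hU
          obtain ⟨J, hJ, hUJ⟩ := ih hU.2
          obtain ⟨J', haJ'⟩ := (hmem a).1 hU.1
          obtain ⟨J'', h'', h1, h2⟩ := hdir J hJ J' J'.2
          exact ⟨J'', h'', by
            rw [Finset.coe_insert, Set.insert_subset_iff]
            exact ⟨h2 haJ', hUJ.trans h1⟩⟩
      obtain ⟨J, hJ, hTJ⟩ := key T (hT ▸ subset_rdSpan _)
      refine (hc hJ).2 ⟨T, le_antisymm ?_ (rdSpan_le (hc hJ).1 hTJ)⟩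
      rw [← hT]
      exact le_sSup hJ) I₀ ⟨hI₀, hn⟩
  obtain ⟨hP, hPn⟩ := hmax.prop
  have hfin : ∀ a ∉ P, ∃ T : Finset B, (T : Set B) ⊆ P ∧
      (P : Set B) ⊆ rdSpan δ (insert a (T : Set B)) := by
    intro a ha
    apply RDFinite.exists_subset_insert
    by_contra hcon
    have hle : P ≤ rdSpan δ (insert a (P : Set B)) :=
      fun x hx => subset_rdSpan _ (Set.mem_insert_of_mem a hx)
    exact ha (hmax.le_of_ge ⟨isRadDiff_rdSpan _, hcon⟩ hle (subset_rdSpan _ (by simp)))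
  refine ⟨P, ⟨?_, ?_⟩, hP, hPn, hfin⟩
  · rintro rfl
    refine hPn ⟨{1}, ((Ideal.eq_top_iff_one _).2 (subset_rdSpan _ (by simp))).symm⟩
  · intro a b hab
    by_contra! hcon
    obtain ⟨T, hT, hPT⟩ := hfin a hcon.1
    obtain ⟨U, hU, hPU⟩ := hfin b hcon.2
    refine hPn ⟨insert (a * b) (T ∪ U), le_antisymm (fun x hx => ?_) (rdSpan_le hP ?_)⟩
    · have hrd := isRadDiff_rdSpan (δ := δ) ((insert (a * b) (T ∪ U) : Finset B) : Set B)
      have hsub := subset_rdSpan (δ := δ) ((insert (a * b) (T ∪ U) : Finset B) : Set B)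
      -- `x` lies in the ideals generated by `a, T` and by `b, U`, and all products of generators
      -- lie in the ideal of `a * b, T, U`; hence so does `x * x`.
      refine hrd.mem_of_mul_self (mul_mem_of_mem_rdSpan hrd ?_ (hPT hx) (hPU hx))
      rintro s (rfl | hs) t (rfl | ht)
      · exact hsub (by simp)
      · exact Ideal.mul_mem_left _ _ (hsub (by simp [Finset.mem_coe.1 ht]))
      · exact Ideal.mul_mem_right _ _ (hsub (by simp [Finset.mem_coe.1 hs]))
      · exact Ideal.mul_mem_left _ _ (hsub (by simp [Finset.mem_coe.1 ht]))
    · simpa [Set.insert_subset_iff] using ⟨hab, hT, hU⟩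

end RadicalDifferential

noncomputable section

open MvPolynomial

/-! ### Rankings, leaders and derivatives -/

section Ranking

variable {m n : ℕ}

/-- The variable obtained from `y_j ^ θ` by applying `δ_i`. -/
def shift (i : Fin m) (v : Fin n × Theta m) : Fin n × Theta m :=
  (v.1, v.2 + Finsupp.single i 1)

/-- A ranking of the variables `y_j ^ θ`. -/
structure IsRanking {W : Type*} [LinearOrder W] (rk : Fin n × Theta m → W) : Prop where
  injective : Function.Injective rk
  shift_lt_shift : ∀ i {u v}, rk u < rk v → rk (shift i u) < rk (shift i v)
  lt_shift : ∀ i v, rk v < rk (shift i v)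

/-- Exponents are compared first, by a monomial order, with ties broken by the index `j`;
translation invariance of the monomial order gives compatibility with derivations. -/
theorem exists_isRanking (m n : ℕ) :
    ∃ (W : Type) (_ : LinearOrder W) (_ : WellFoundedLT W) (rk : Fin n × Theta m → W),
      IsRanking rk := by
  let μ : MonomialOrder (Fin m) := MonomialOrder.lex
  refine ⟨μ.syn ×ₗ Fin n, inferInstance, inferInstance, fun v => toLex (μ.toSyn v.2, v.1),
    ⟨?_, ?_, ?_⟩⟩
  · rintro ⟨j, θ⟩ ⟨k, η⟩ h
    have := toLex.injective h
    simp only [Prod.mk.injEq, EmbeddingLike.apply_eq_iff_eq] at this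
    rw [this.1, this.2]
  · rintro i ⟨j, θ⟩ ⟨k, η⟩ h
    rw [Prod.Lex.toLex_lt_toLex] at h ⊢
    simpa [shift] using h
  · rintro i ⟨j, θ⟩
    rw [Prod.Lex.toLex_lt_toLex]
    left
    refine μ.toSyn_strictMono (lt_of_le_of_ne le_self_add fun h => ?_)
    simpa [shift] using DFunLike.congr_fun h i

/-- A set of variables has finitely many minimal elements under the relation of being a
derivative. -/
theorem exists_finite_generators (L : Set (Fin n × Theta m)) :
    ∃ T ⊆ L, T.Finite ∧ ∀ v ∈ L, ∃ u ∈ T, ∃ η, v = (u.1, u.2 + η) := by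
  let M : Fin n → Set (Theta m) := fun j => {θ | Minimal (fun θ => (j, θ) ∈ L) θ}
  refine ⟨⋃ j, Prod.mk j '' M j, ?_, ?_, ?_⟩
  · rintro v hv
    obtain ⟨j, θ, hθ, rfl⟩ := Set.mem_iUnion.1 hv
    exact (Set.mem_ofPred.1 hθ).prop
  -- Dickson's lemma: the minimal exponents form an antichain, hence a finite set.
  · exact Set.finite_iUnion fun j => Set.Finite.image _
      (WellQuasiOrderedLE.finite_of_isAntichain (setOfPred_minimal_antichain _))
  · rintro ⟨j, θ⟩ hv
    obtain ⟨η, hη, hmin⟩ := exists_minimal_le_of_wellFoundedLT (fun θ => (j, θ) ∈ L) θ hv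
    exact ⟨(j, η), Set.mem_iUnion.2 ⟨j, η, hmin, rfl⟩, θ - η, by
      rw [add_tsub_cancel_of_le hη]⟩

variable {R A : Type*} [CommRing R] [CommRing A] [Algebra R A]
  {W : Type*} [LinearOrder W] {rk : Fin n × Theta m → W}

/-- Polynomials in the variables of rank lower than `v`. -/
def lower (A : Type*) [CommRing A] (rk : Fin n × Theta m → W) (v : Fin n × Theta m) :
    Subalgebra A (DiffPoly A m n) :=
  supported A {w | rk w < rk v}

theorem X_mem_lower {v w : Fin n × Theta m} (h : rk w < rk v) :
    (X w : DiffPoly A m n) ∈ lower A rk v :=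
  Algebra.subset_adjoin ⟨w, h, rfl⟩

theorem lower_mono {v w : Fin n × Theta m} (h : rk v ≤ rk w) : lower A rk v ≤ lower A rk w :=
  supported_mono fun _ hu => lt_of_lt_of_le hu h

theorem IsRanking.polyDerivation_mem_lower (hrk : IsRanking rk) (δ : Fin m → Derivation R A A)
    (i : Fin m) {v : Fin n × Theta m} {g : DiffPoly A m n} (hg : g ∈ lower A rk v) :
    polyDerivation δ n i g ∈ lower A rk (shift i v) := by
  have hle : lower A rk v ≤ lower A rk (shift i v) := lower_mono (hrk.lt_shift i v).le
  refine Algebra.adjoin_induction (p := fun g _ => polyDerivation δ n i g ∈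
    lower A rk (shift i v)) ?_ ?_ ?_ ?_ hg
  · rintro _ ⟨w, hw, rfl⟩
    rw [polyDerivation_X]
    exact X_mem_lower (hrk.shift_lt_shift i hw)
  · intro a
    rw [MvPolynomial.algebraMap_eq, polyDerivation_C]
    exact Subalgebra.algebraMap_mem _ _
  · intro x y _ _ hx hy
    rw [map_add]
    exact add_mem hx hy
  · intro x y hx' hy' hx hy
    rw [Derivation.leibniz]
    exact add_mem (mul_mem (hle hx') hy) (mul_mem (hle hy') hx)

theorem aeval_X_mem_lower {v w : Fin n × Theta m} (h : rk v < rk w)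
    (p : Polynomial (lower A rk v)) :
    Polynomial.aeval (X v : DiffPoly A m n) p ∈ lower A rk w := by
  rw [Polynomial.aeval_eq_sum_range]
  refine sum_mem fun j _ => ?_
  rw [Algebra.smul_def]
  exact mul_mem (lower_mono h.le (p.coeff j).2) (pow_mem (X_mem_lower h) j)

/-- The chain rule: differentiating `X v` produces the separant times the new leader, while
differentiating the coefficients produces only variables ranked below it. -/
theorem IsRanking.polyDerivation_aeval (hrk : IsRanking rk) (δ : Fin m → Derivation R A A)
    (i : Fin m) {v : Fin n × Theta m} (p : Polynomial (lower A rk v)) :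
    ∃ h ∈ lower A rk (shift i v), polyDerivation δ n i (Polynomial.aeval (X v) p) =
      Polynomial.aeval (X v) (Polynomial.derivative p) * X (shift i v) + h := by
  induction p using Polynomial.induction_on' with
  | add p q hp hq =>
    obtain ⟨h, hh, hp⟩ := hp
    obtain ⟨k, hk, hq⟩ := hq
    refine ⟨h + k, add_mem hh hk, ?_⟩
    simp only [map_add, hp, hq]
    ring
  | monomial j a =>
    refine ⟨X v ^ j * polyDerivation δ n i a.1, mul_mem (pow_mem (X_mem_lower
      (hrk.lt_shift i v)) j) (hrk.polyDerivation_mem_lower δ i a.2), ?_⟩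
    rw [Polynomial.derivative_monomial, Polynomial.aeval_monomial, Polynomial.aeval_monomial,
      Derivation.leibniz, Derivation.leibniz_pow, polyDerivation_X]
    simp only [map_mul, map_natCast, smul_eq_mul, nsmul_eq_mul, shift]
    rw [show algebraMap (lower A rk v) (DiffPoly A m n) a = a.1 from rfl]
    ring

theorem IsRanking.exists_aeval_eq (hrk : IsRanking rk) {v : Fin n × Theta m}
    {g : DiffPoly A m n} (hg : g ∈ supported A {w | rk w ≤ rk v}) :
    ∃ p : Polynomial (lower A rk v), Polynomial.aeval (X v : DiffPoly A m n) p = g := by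
  refine Algebra.adjoin_induction (p := fun g _ => ∃ p : Polynomial (lower A rk v),
    Polynomial.aeval (X v : DiffPoly A m n) p = g) ?_ ?_ ?_ ?_ hg
  · rintro _ ⟨w, hw, rfl⟩
    rcases (show rk w ≤ rk v from hw).lt_or_eq with h | h
    · exact ⟨Polynomial.C ⟨X w, X_mem_lower h⟩, Polynomial.aeval_C _ _⟩
    · exact ⟨Polynomial.X, by rw [Polynomial.aeval_X, hrk.injective h]⟩
  · exact fun a => ⟨Polynomial.C (algebraMap A _ a), Polynomial.aeval_C _ _⟩
  · rintro x y _ _ ⟨p, rfl⟩ ⟨q, rfl⟩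
    exact ⟨p + q, map_add _ _ _⟩
  · rintro x y _ _ ⟨p, rfl⟩ ⟨q, rfl⟩
    exact ⟨p * q, map_mul _ _ _⟩

theorem exists_leader (rk : Fin n × Theta m → W) (g : DiffPoly A m n) :
    (∃ a, g = C a) ∨ ∃ v ∈ g.vars, g ∈ supported A {w | rk w ≤ rk v} := by
  rcases g.vars.eq_empty_or_nonempty with h | h
  · left
    have : g ∈ supported A (∅ : Set (Fin n × Theta m)) := by rw [mem_supported, h]; simp
    rw [supported_empty, Algebra.mem_bot] at this
    obtain ⟨a, ha⟩ := this
    exact ⟨a, ha.symm⟩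
  · right
    obtain ⟨v, hv, hmax⟩ := g.vars.exists_max_image rk h
    exact ⟨v, hv, mem_supported.2 fun w hw => hmax w hw⟩

end Ranking

/-! ### Pseudo-division and the Ritt–Raudenbush basis theorem -/

section RittRaudenbush

variable {R A : Type*} [CommRing R] [CommRing A] [Algebra R A] {m n : ℕ}
  {W : Type*} [LinearOrder W] {rk : Fin n × Theta m → W}

/-- Nonzero integers are units because `R` contains `ℚ`. This is what keeps separants outside `P`.
-/
theorem mem_of_mul_natCast_mem {R B : Type*} [CommRing R] [Algebra ℚ R] [CommRing B]
    [Algebra R B] {I : Ideal B} {x : B} {d : ℕ} (hd : d ≠ 0) (h : x * d ∈ I) : x ∈ I := by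
  have h1 : (d : B) * algebraMap R B (algebraMap ℚ R (d : ℚ)⁻¹) = 1 := by
    rw [← map_natCast (algebraMap R B) d, ← map_natCast (algebraMap ℚ R) d, ← map_mul, ← map_mul,
      mul_inv_cancel₀ (by exact_mod_cast hd), map_one, map_one]
  have := I.mul_mem_right (algebraMap R B (algebraMap ℚ R (d : ℚ)⁻¹)) h
  rwa [mul_assoc, h1, mul_one] at this

theorem theta_induction {Q : Theta m → Prop} (h0 : Q 0)
    (hs : ∀ θ i, Q θ → Q (θ + Finsupp.single i 1)) (η : Theta m) : Q η := by
  have main : ∀ θ, Q θ → Q (θ + η) := by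
    induction η using Finsupp.induction_linear with
    | zero => intro θ h; rwa [add_zero]
    | add f g hf hg => intro θ h; rw [← add_assoc]; exact hg _ (hf _ h)
    | single i k =>
      induction k with
      | zero => intro θ h; rwa [Finsupp.single_zero, add_zero]
      | succ k ih => intro θ h; rw [Finsupp.single_add, ← add_assoc]; exact hs _ _ (ih _ h)
  simpa using main 0 h0

/-- One step of pseudo-division. -/
theorem exists_aeval_eq_sub {K B : Type*} [CommRing K] [CommRing B] [Algebra K B] (x : B)
    {p q : Polynomial K} (hp : p.natDegree ≠ 0) (hq : q.natDegree ≤ p.natDegree) :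
    ∃ (r : Polynomial K) (u : B), r.natDegree < p.natDegree ∧ Polynomial.aeval x r =
      algebraMap K B q.leadingCoeff * Polynomial.aeval x p - u * Polynomial.aeval x q := by
  set r := Polynomial.C q.leadingCoeff * p -
    Polynomial.C p.leadingCoeff * (Polynomial.X ^ (p.natDegree - q.natDegree) * q) with hr
  have hrd : r.natDegree ≤ p.natDegree := by
    refine (Polynomial.natDegree_sub_le_of_le (Polynomial.natDegree_C_mul_le _ _)
      ((Polynomial.natDegree_C_mul_le _ _).trans (Polynomial.natDegree_mul_le_of_le
        (Polynomial.natDegree_X_pow_le _) le_rfl))).trans ?_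
    omega
  have hrc : r.coeff p.natDegree = 0 := by
    rw [hr, Polynomial.coeff_sub, Polynomial.coeff_C_mul, Polynomial.coeff_C_mul,
      Polynomial.coeff_X_pow_mul', if_pos (Nat.sub_le _ _), Nat.sub_sub_self hq]
    simp only [Polynomial.coeff_natDegree]
    ring
  refine ⟨r, algebraMap K B p.leadingCoeff * x ^ (p.natDegree - q.natDegree),
    lt_of_le_of_ne hrd fun h => hp ?_, ?_⟩
  -- If the degree did not drop, the leading coefficient of `r` would vanish, so `r = 0` and its
  -- `natDegree` is `0`, which `hp` excludes.
  · rw [← h, Polynomial.leadingCoeff_eq_zero.1 (show r.coeff r.natDegree = 0 by rwa [h])]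
    exact Polynomial.natDegree_zero
  · simp only [hr, map_sub, map_mul, map_pow, Polynomial.aeval_C, Polynomial.aeval_X, mul_assoc]

/-- `p`, as a polynomial in the variable `v`, is nonconstant modulo `P` and lies in `P`. -/
structure IsLeading (P : Ideal (DiffPoly A m n)) (v : Fin n × Theta m)
    (p : Polynomial (lower A rk v)) : Prop where
  natDegree_ne_zero : p.natDegree ≠ 0
  aeval_mem : Polynomial.aeval (X v : DiffPoly A m n) p ∈ P
  leadingCoeff_notMem : (p.leadingCoeff : DiffPoly A m n) ∉ P

/-- The separant of a polynomial of minimal degree does not lie in the ideal. -/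
theorem IsLeading.aeval_derivative_notMem (R : Type*) [CommRing R] [Algebra ℚ R] [Algebra R A]
    {P : Ideal (DiffPoly A m n)} {v : Fin n × Theta m} {p : Polynomial (lower A rk v)}
    (hp : IsLeading P v p) (hmin : ∀ q : Polynomial (lower A rk v), IsLeading P v q → p.natDegree ≤ q.natDegree) :
    Polynomial.aeval (X v : DiffPoly A m n) (Polynomial.derivative p) ∉ P := by
  intro hmem
  obtain ⟨d, hd⟩ := Nat.exists_eq_succ_of_ne_zero hp.natDegree_ne_zero
  -- This coefficient is `d + 1` times the initial of `p`.
  have hc : ((Polynomial.derivative p).coeff d : DiffPoly A m n) ∉ P := by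
    rw [Polynomial.coeff_derivative]
    intro h
    refine hp.leadingCoeff_notMem (mem_of_mul_natCast_mem (R := R) (d := d + 1) (by simp) ?_)
    rw [Polynomial.leadingCoeff, hd]
    simpa using h
  have hdeg : (Polynomial.derivative p).natDegree = d := by
    refine le_antisymm ?_ (Polynomial.le_natDegree_of_ne_zero fun h => hc ?_)
    · have := Polynomial.natDegree_derivative_le p
      omega
    · rw [h]; exact P.zero_mem
  -- When `d = 0` minimality says nothing, as `IsLeading` demands positive degree; but then the
  -- separant is the coefficient just shown to lie outside `P`.
  by_cases h0 : d = 0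
  · subst h0
    rw [Polynomial.eq_C_of_natDegree_eq_zero hdeg, Polynomial.aeval_C] at hmem
    exact hc hmem
  · have := hmin _ ⟨by rwa [hdeg], hmem, by rwa [Polynomial.leadingCoeff, hdeg]⟩
    omega

/-- The proper derivatives of a polynomial are linear in their leader, and the coefficient of the
leader is the separant. -/
theorem IsRanking.exists_linear_mem (hrk : IsRanking rk) (δ : Fin m → Derivation R A A)
    {J : Ideal (DiffPoly A m n)} (hJ : IsDifferentialIdeal (polyDerivation δ n) J)
    {u : Fin n × Theta m} {p : Polynomial (lower A rk u)}
    (hp : Polynomial.aeval (X u : DiffPoly A m n) p ∈ J) (η : Theta m) :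
    η = 0 ∨ Polynomial.aeval (X u : DiffPoly A m n) (Polynomial.derivative p) ∈
        lower A rk (u.1, u.2 + η) ∧
      ∃ h ∈ lower A rk (u.1, u.2 + η),
        Polynomial.aeval (X u) (Polynomial.derivative p) * X (u.1, u.2 + η) + h ∈ J := by
  induction η using theta_induction with
  | h0 => exact Or.inl rfl
  | hs η i ih =>
    right
    rw [← add_assoc]
    rcases ih with rfl | ⟨hs, h, hh, hmem⟩
    · rw [add_zero]
      obtain ⟨h, hh, heq⟩ := hrk.polyDerivation_aeval δ i p
      have hmem := hJ i _ hp
      rw [heq] at hmem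
      exact ⟨aeval_X_mem_lower (hrk.lt_shift i u) _, h, hh, hmem⟩
    · rw [show (u.1, u.2 + η + Finsupp.single i 1) = shift i (u.1, u.2 + η) from rfl]
      generalize (u.1, u.2 + η) = w at *
      have hlt := hrk.lt_shift i w
      -- Leibniz applied to `S * X w + h`, with `S` the separant: the part `X w * δ_i S + δ_i h`
      -- ranks below the new leader.
      refine ⟨lower_mono hlt.le hs, X w * polyDerivation δ n i (Polynomial.aeval (X u)
        (Polynomial.derivative p)) + polyDerivation δ n i h,
        add_mem (mul_mem (X_mem_lower hlt) (hrk.polyDerivation_mem_lower δ i hs))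
          (hrk.polyDerivation_mem_lower δ i hh), ?_⟩
      have := hJ i _ hmem
      rwa [map_add, Derivation.leibniz, polyDerivation_X, smul_eq_mul, smul_eq_mul,
        add_assoc] at this

/-- Pseudo-division: if every variable occurring as a leader in `P` is the leader of an element of
`J` of minimal degree whose initial divides `s`, then `s` multiplies `P` into `J`. -/
theorem IsRanking.mul_mem_of_forall_leader [WellFoundedLT W] (hrk : IsRanking rk)
    {P J : Ideal (DiffPoly A m n)} (hJ : J.IsRadical) (hJP : J ≤ P)
    (hC : ∀ a, C a ∈ P → C a ∈ J) {s : DiffPoly A m n}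
    (hs : ∀ v, ∀ p : Polynomial (lower A rk v), IsLeading P v p →
      ∃ q : Polynomial (lower A rk v), Polynomial.aeval (X v : DiffPoly A m n) q ∈ J ∧
        (q.leadingCoeff : DiffPoly A m n) ∣ s ∧ q.natDegree ≤ p.natDegree)
    {g : DiffPoly A m n} (hg : g ∈ P) : s * g ∈ J := by
  have step : ∀ v, (∀ g ∈ P, g ∈ lower A rk v → s * g ∈ J) →
      ∀ p : Polynomial (lower A rk v), Polynomial.aeval (X v : DiffPoly A m n) p ∈ P →
        s * Polynomial.aeval (X v : DiffPoly A m n) p ∈ J := by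
    intro v hv p
    induction hd : p.natDegree using Nat.strong_induction_on generalizing p with
    | _ d ih =>
      intro hp
      by_cases h0 : d = 0
      · rw [h0] at hd
        rw [Polynomial.eq_C_of_natDegree_eq_zero hd, Polynomial.aeval_C] at hp ⊢
        exact hv _ hp (p.coeff 0).2
      -- A leading coefficient in `P` is covered by the hypothesis on lower polynomials and can be
      -- stripped off; otherwise `p` is `IsLeading` and can be reduced by some `q`.
      by_cases hlc : (p.leadingCoeff : DiffPoly A m n) ∈ P
      · have heq : Polynomial.aeval (X v : DiffPoly A m n) p =
            Polynomial.aeval (X v) p.eraseLead + (p.leadingCoeff : DiffPoly A m n) * X v ^ d := by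
          conv_lhs => rw [← p.eraseLead_add_C_mul_X_pow]
          rw [map_add, map_mul, map_pow, Polynomial.aeval_C, Polynomial.aeval_X, hd]
          rfl
        have hp' : Polynomial.aeval (X v : DiffPoly A m n) p.eraseLead ∈ P := by
          rw [heq] at hp
          exact (P.add_mem_iff_left (P.mul_mem_right _ hlc)).1 hp
        have hlt := p.eraseLead_natDegree_le
        rw [heq, mul_add, ← mul_assoc]
        exact J.add_mem (ih _ (by omega) _ rfl hp')
          (J.mul_mem_right _ (hv _ hlc p.leadingCoeff.2))
      · obtain ⟨q, hq, ⟨t, ht⟩, hdeg⟩ := hs v p ⟨hd ▸ h0, hp, hlc⟩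
        obtain ⟨r, u, hrlt, heq⟩ := exists_aeval_eq_sub (X v : DiffPoly A m n) (hd ▸ h0) hdeg
        rw [hd] at hrlt
        have hrP : Polynomial.aeval (X v : DiffPoly A m n) r ∈ P :=
          heq ▸ P.sub_mem (P.mul_mem_left _ hp) (P.mul_mem_left _ (hJP hq))
        have hrJ := ih _ hrlt r rfl hrP
        rw [heq, mul_sub] at hrJ
        have hpJ := (J.sub_mem_iff_left (J.mul_mem_left _ (J.mul_mem_left _ hq))).1 hrJ
        -- Reduction gives `s * (c * y) ∈ J` with `c` the initial of `q` and `y` the value of `p`.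
        -- As `s = c * t`, multiplying by `t * y` gives `(s * y) ^ 2`. Radicality thus lets one `s`
        -- serve for any number of reductions.
        refine hJ ⟨2, ?_⟩
        convert J.mul_mem_left (t * Polynomial.aeval (X v : DiffPoly A m n) p) hpJ using 1
        generalize Polynomial.aeval (X v : DiffPoly A m n) p = y
        rw [pow_two]
        nth_rewrite 2 [ht]
        change _ = t * y * (s * (q.leadingCoeff.1 * y))
        ring
  have main : ∀ v, ∀ g ∈ P, g ∈ supported A {w | rk w ≤ rk v} → s * g ∈ J := by
    intro v
    induction v using (InvImage.wf rk wellFounded_lt).induction with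
    -- Noetherian induction on the leader: polynomials in lower variables either are constants or
    -- have a lower leader.
    | _ v ih =>
      intro g hg hv
      obtain ⟨p, rfl⟩ := hrk.exists_aeval_eq hv
      refine step v (fun g hg hlow => ?_) p hg
      rcases exists_leader rk g with ⟨a, rfl⟩ | ⟨w, hw, hgw⟩
      · exact J.mul_mem_left _ (hC a hg)
      · exact ih w (mem_supported.1 hlow hw) g hg hgw
  rcases exists_leader rk g with ⟨a, rfl⟩ | ⟨w, -, hgw⟩
  · exact J.mul_mem_left _ (hC a hg)
  · exact main w g hg hgw

/-- A prime differential ideal is determined by finitely many of its elements and its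
constants, up to an element outside of it. -/
theorem exists_finite_mul_mem [Algebra ℚ R] (δ : Fin m → Derivation R A A)
    (P : Ideal (DiffPoly A m n)) [P.IsPrime] :
    ∃ F : Set (DiffPoly A m n), F.Finite ∧ F ⊆ P ∧ ∃ s ∉ P, ∀ J,
      IsRadDiff (polyDerivation δ n) J → J ≤ P → F ⊆ J → (∀ a, C a ∈ P → C a ∈ J) →
        ∀ g ∈ P, s * g ∈ J := by
  obtain ⟨W, _, _, rk, hrk⟩ := exists_isRanking m n
  have hmin : ∀ v, ∃ p : Polynomial (lower A rk v), (∃ q, IsLeading (rk := rk) P v q) →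
      IsLeading P v p ∧ ∀ q : Polynomial (lower A rk v), IsLeading P v q → p.natDegree ≤ q.natDegree := by
    intro v
    by_cases h : ∃ q, IsLeading (rk := rk) P v q
    · obtain ⟨p, hp⟩ := exists_minimalFor_of_wellFoundedLT _ Polynomial.natDegree h
      exact ⟨p, fun _ => ⟨hp.prop, fun q hq => (le_total _ _).elim id (hp.le_of_le hq)⟩⟩
    · exact ⟨0, fun h' => absurd h' h⟩
  choose p hp using hmin
  obtain ⟨T, hTL, hTfin, hT⟩ :=
    exists_finite_generators {v : Fin n × Theta m | ∃ q, IsLeading (rk := rk) P v q}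
  have hsep : ∀ v ∈ T, Polynomial.aeval (X v : DiffPoly A m n) (Polynomial.derivative (p v)) ∉ P :=
    fun v hv => (hp v (hTL hv)).1.aeval_derivative_notMem R (hp v (hTL hv)).2
  refine ⟨(fun v => Polynomial.aeval (X v : DiffPoly A m n) (p v)) '' T, hTfin.image _, ?_,
    ∏ v ∈ hTfin.toFinset, ((p v).leadingCoeff : DiffPoly A m n) *
      Polynomial.aeval (X v : DiffPoly A m n) (Polynomial.derivative (p v)), ?_, ?_⟩
  · rintro _ ⟨v, hv, rfl⟩
    exact (hp v (hTL hv)).1.aeval_mem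
  · intro hmem
    obtain ⟨v, hv, hmem⟩ := (Ideal.IsPrime.prod_mem_iff).1 hmem
    rw [Set.Finite.mem_toFinset] at hv
    rcases Ideal.IsPrime.mem_or_mem ‹_› hmem with h | h
    · exact (hp v (hTL hv)).1.leadingCoeff_notMem h
    · exact hsep v hv h
  · intro J hJ hJP hFJ hC g hg
    refine hrk.mul_mem_of_forall_leader hJ.radical hJP hC (fun v q hq => ?_) hg
    obtain ⟨u, hu, η, hv⟩ := hT v ⟨q, hq⟩
    have hdvd := Finset.dvd_prod_of_mem (fun v => ((p v).leadingCoeff : DiffPoly A m n) *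
      Polynomial.aeval (X v : DiffPoly A m n) (Polynomial.derivative (p v)))
      (hTfin.mem_toFinset.2 hu)
    have hlinear := hrk.exists_linear_mem δ hJ.differential (hFJ ⟨u, hu, rfl⟩) η
    rw [← hv] at hlinear
    -- Either `v` is itself one of the finitely many leaders, and `p v` has least degree, or it is a
    -- proper derivative of one. In that case the differentiated `p u` is linear in `v` with its
    -- separant as initial, and degree `1` is small enough.
    rcases hlinear with rfl | ⟨hmem, h, hh, hlin⟩
    · obtain rfl : v = u := by rw [hv, add_zero]
      exact ⟨p v, hFJ ⟨v, hu, rfl⟩, (dvd_mul_right _ _).trans hdvd, (hp v ⟨q, hq⟩).2 q hq⟩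
    · set a : lower A rk v := ⟨_, hmem⟩
      have ha : a ≠ 0 := fun h0 => hsep u hu (by
        rw [show Polynomial.aeval (X u : DiffPoly A m n) (Polynomial.derivative (p u)) = a.1
          from rfl, h0]
        exact P.zero_mem)
      refine ⟨Polynomial.C a * Polynomial.X + Polynomial.C ⟨h, hh⟩, ?_, ?_, ?_⟩
      · rw [map_add, map_mul, Polynomial.aeval_C, Polynomial.aeval_C, Polynomial.aeval_X]
        exact hlin
      · rw [Polynomial.leadingCoeff_linear ha]
        exact (dvd_mul_left _ _).trans hdvd
      · rw [Polynomial.natDegree_linear ha]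
        exact Nat.one_le_iff_ne_zero.2 hq.natDegree_ne_zero

theorem isRadDiff_comap_C {δ : Fin m → Derivation R A A} {I : Ideal (DiffPoly A m n)}
    (hI : IsRadDiff (polyDerivation δ n) I) : IsRadDiff δ (I.comap C) where
  radical := hI.radical.comap C
  differential i a ha := by
    rw [Ideal.mem_comap] at ha ⊢
    rw [← polyDerivation_C]
    exact hI.differential i _ ha

/-- The Ritt–Raudenbush basis theorem. -/
theorem RadicallyNoetherian.rdFinite_diffPoly [Algebra ℚ R] {δ : Fin m → Derivation R A A}
    (hδ : RadicallyNoetherian δ) {I : Ideal (DiffPoly A m n)}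
    (hI : IsRadDiff (polyDerivation δ n) I) : RDFinite (polyDerivation δ n) I := by
  classical
  by_contra hn
  obtain ⟨P, hPp, hP, hPn, hfin⟩ := exists_prime_maximal_not_rdFinite hI hn
  obtain ⟨F, hFfin, hFP, s, hs, hF⟩ := exists_finite_mul_mem δ P
  obtain ⟨T, hT⟩ := hδ.rdFinite (isRadDiff_comap_C hP)
  obtain ⟨U, hU, hPU⟩ := hfin s hs
  set V : Finset (DiffPoly A m n) := hFfin.toFinset ∪ T.image C ∪ U
  have hJ := isRadDiff_rdSpan (δ := polyDerivation δ n) (V : Set (DiffPoly A m n))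
  have hVJ := subset_rdSpan (δ := polyDerivation δ n) (V : Set (DiffPoly A m n))
  have hTP : ∀ a ∈ T, C a ∈ P := fun a ha => by
    have : a ∈ P.comap C := hT ▸ subset_rdSpan _ ha
    exact this
  have hJP : rdSpan (polyDerivation δ n) (V : Set (DiffPoly A m n)) ≤ P := by
    refine rdSpan_le hP ?_
    simp only [V, Finset.coe_union, Set.Finite.coe_toFinset, Finset.coe_image, Set.union_subset_iff]
    exact ⟨⟨hFP, by rintro _ ⟨a, ha, rfl⟩; exact hTP a ha⟩, hU⟩
  have hmul := hF _ hJ hJP (fun x hx => hVJ (by simp [V, hx])) (fun a ha => by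
    have h1 : a ∈ rdSpan δ (T : Set A) := hT ▸ ha
    exact rdSpan_le (isRadDiff_comap_C hJ)
      (fun b hb => hVJ (by simp [V, Finset.mem_coe.1 hb])) h1)
  refine hPn ⟨V, le_antisymm (fun x hx => hJ.mem_of_mul_self ?_) hJP⟩
  -- The elements whose product with `x` lies in `J` include `s` and `U`, hence all of `P`, hence
  -- `x`.
  refine mem_colonElem.1 (rdSpan_le (hJ.colonElem x) ?_ (hPU hx))
  rintro t (rfl | ht)
  · rw [SetLike.mem_coe, mem_colonElem, mul_comm]
    exact hmul x hx
  · exact Ideal.mul_mem_left _ _ (hVJ (by simp [V, Finset.mem_coe.1 ht]))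

end RittRaudenbush

/-! ### Zero sets and the Zariski topology -/

section Zariski

variable {R A : Type*} [CommRing R] [CommRing A] [Algebra R A] {m n : ℕ}
  {δ : Fin m → Derivation R A A}

/-- Reducedness of `A` gives radicality; evaluation commuting with the derivations gives stability.
-/
theorem isRadDiff_ker_evalAt [IsReduced A] (hδ : PairwiseCommute δ) (a : Fin n → A) :
    IsRadDiff (polyDerivation δ n) (RingHom.ker (evalAt δ a)) where
  radical := by
    rintro x ⟨k, hk⟩
    rw [RingHom.mem_ker, map_pow] at hk
    exact eq_zero_of_pow_eq_zero hk
  differential i x hx := by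
    rw [RingHom.mem_ker] at hx ⊢
    rw [(evalAt_spec hδ a).1, hx, map_zero]

theorem exists_finset_zeroSet_eq [Algebra ℚ R] [IsReduced A] (hδ : PairwiseCommute δ)
    (hacc : RadicallyNoetherian δ) (S : Set (DiffPoly A m n)) :
    ∃ T : Finset (DiffPoly A m n), (T : Set (DiffPoly A m n)) ⊆ S ∧
      zeroSet δ (T : Set (DiffPoly A m n)) = zeroSet δ S := by
  obtain ⟨T, hTS, hT⟩ := RDFinite.exists_subset
    (hacc.rdFinite_diffPoly (isRadDiff_rdSpan (δ := polyDerivation δ n) S))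
  refine ⟨T, hTS, Set.Subset.antisymm (fun a ha f hf => ?_) fun a ha f hf => ha f (hTS hf)⟩
  exact rdSpan_le (isRadDiff_ker_evalAt hδ a) (fun g hg => ha g hg) (hT ▸ subset_rdSpan S hf)

theorem RadicallyNoetherian.equationallyNoetherian [Algebra ℚ R] [IsReduced A]
    (hδ : PairwiseCommute δ) (hacc : RadicallyNoetherian δ) : EquationallyNoetherian δ := by
  intro n
  let := zariskiTopology δ n
  rw [TopologicalSpace.noetherianSpace_iff_opens]
  intro s
  -- Alexander's subbasis theorem: only covers by complements of zero sets need be considered.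
  refine isCompact_generateFrom rfl fun Q hQ hs => ?_
  have hQ' : ∀ U : Set (Fin n → A), ∃ S : Set (DiffPoly A m n), U ∈ Q → U = (zeroSet δ S)ᶜ := by
    intro U
    by_cases hU : U ∈ Q
    · exact (hQ hU).imp fun S hS _ => hS
    · exact ⟨∅, fun h => absurd h hU⟩
  choose S hS using hQ'
  -- A point missed by the whole cover `Q` is a common zero of all these equations, and finitely
  -- many of them cut out the same set. One member of `Q` per equation in `T` therefore covers as
  -- much as `Q`.
  obtain ⟨T, hTS, hT⟩ := exists_finset_zeroSet_eq hδ hacc (⋃ U ∈ Q, S U)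
  have hmem : ∀ f ∈ T, ∃ U ∈ Q, f ∈ S U := fun f hf => by simpa using hTS hf
  choose! U hUQ hfU using hmem
  refine ⟨U '' T, ?_, T.finite_toSet.image U, fun a ha => ?_⟩
  · rintro _ ⟨f, hf, rfl⟩
    exact hUQ f hf
  · by_contra hcon
    have haT : a ∈ zeroSet δ (T : Set (DiffPoly A m n)) := by
      intro f hf
      by_contra hne
      refine hcon ⟨U f, ⟨f, hf, rfl⟩, ?_⟩
      rw [hS _ (hUQ f hf)]
      exact fun h => hne (h f (hfU f hf))
    rw [hT] at haT
    obtain ⟨V, hV, haV⟩ := hs ha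
    rw [hS _ hV] at haV
    exact haV fun f hf => haT f (Set.mem_biUnion hV hf)

end Zariski

end

end DiffAlg

theorem theorem2 {R A : Type*} [CommRing R] [Algebra ℚ R] [CommRing A] [Algebra R A] {m : ℕ}
    (δ : Fin m → Derivation R A A) (hδ : DiffAlg.PairwiseCommute δ)
    (hred : IsReduced A) (hacc : DiffAlg.RadicallyNoetherian δ) :
    DiffAlg.EquationallyNoetherian δ := by
  exact hacc.equationallyNoetherian hδ
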